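/- \textbf{Setting.} Let $\mathbb{X}$ be a locally compact second-countable Hausdorff group with neutral element $e$ which is unimodular, i.e. its left Haar measure $\lambda$ is also right invariant. Let $(\Omega,\mathcal{A},\mathbf{P})$ be a probability space with a jointly measurable, $\mathbf{P}$-preserving left action $\theta:\mathbb{X}\times\Omega\to\Omega$. Let $\mathfrak{m}$ be a simple point process on $\mathbb{X}$, i.e. a random locally finite counting measure without multiple points, measurable in the sense that $\omega\mapsto\mathfrak{m}(\omega,B)$ is measurable for each Borel set $B$, and identified with its set of points. Assume that $\mathfrak m$ is flow-adapted, i.e. $\mathfrak{m}(\theta_x\omega,B)=\mathfrak{m}(\omega,x^{-1}B)$ for all $x\in\mathbb{X}$, $\omega\in\Omega$ and Borel $B$, and that the measure $\mathbf{E}[\mathfrak{m}(\cdot)]$ is locally finite and non-zero. Its Palm probability measure is $$\mathbf{P}^{\mathfrak{m}}(A)=\frac{1}{c}\,\mathbf{E}\int_{\mathbb{X}}1_{\{\theta_x^{-1}\omega\in A\}}\,w(x)\,\mathfrak{m}(\omega,dx),\qquad A\in\mathcal{A},$$ where $c=\mathbf{E}[\mathfrak{m}(B)]/\lambda(B)$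 for any Borel $B$ with $\lambda(B)\in(0,\infty)$, and $w:\mathbb{X}\to[0,\infty)$ is any measurable function with $\int w\,d\lambda=1$. \textbf{Networks.} A network is a connected, locally finite simple graph (possibly empty) with marks in a fixed complete separable metric space $\Xi$ on its vertices and on its pairs (vertex, incident edge). Let $\mathcal{G}_*$ and $\mathcal{G}_{**}$ be the sets of isomorphism classes $[G,o]$ and $[G,o,v]$ of networks with one distinguished vertex $o$ and with two distinguished vertices $o,v$, respectively. They carry the Borel $\sigma$-algebras of the topologies whose neighbourhoods are given by the distance $2^{-\alpha}$. For $\mathcal{G}_*$, $\alpha$ is the supremum of those $r>0$ such that there is a rooted isomorphism between the balls of radius $\lceil r\rceil$ around the roots for which corresponding marks are at distance at most $1/r$ ($\alpha=0$ if there is no such $r$). For $\mathcal{G}_{**}$ one requires moreover that the second distinguished vertices lie in these balls and correspond to each other. A unimodular random network is a measurable map $[\boldsymbol{G},\boldsymbol{o}]$ from a probability space to $\mathcal{G}_*$ such that, for all measurable $g:\mathcal{G}_{**}\to[0,\infty)$, $$\mathbf{E}\sum_{v\in V(\boldsymbol{G})}g[\boldsymbol{G},\boldsymbol{o},v]=\mathbf{E}\sum_{v\in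 V(\boldsymbol{G})}g[\boldsymbol{G},v,\boldsymbol{o}].$$ \textbf{Theorem.} Let $\beta$ be a map on $\Omega$ such that, for every $\omega\in\Omega$, $\beta(\omega)$ is a network with mark space $\Xi$ and vertex set $V(\beta(\omega))\subseteq\mathbb{X}$, and such that \begin{enumerate} \item[(i)] $V(\beta)=\mathfrak{m}$; \item[(ii)] $\beta$ is flow-adapted: for all $z\in\mathbb{X}$ and $\omega\in\Omega$, $\beta(\theta_z\omega)$ is the network obtained from $\beta(\omega)$ by shifting each vertex $X$ to $zX$, with edges and all marks carried along; \item[(iii)] $\omega\mapsto[\beta(\omega),e]\in\mathcal{G}_*$ is measurable on the event $\{e\in V(\beta)\}$, and $(\omega,x)\mapsto[\beta(\omega),e,x]\in\mathcal{G}_{**}$ is measurable on $\{(\omega,x)\in\Omega\times\mathbb{X}: e,x\in V(\beta(\omega))\}$. \end{enumerate} Then $\mathbf{P}^{\mathfrak{m}}$ is a probability measure, the event $\{e\in V(\beta)\}=\{e\in\mathfrak{m}\}$ is measurable and has $\mathbf{P}^{\mathfrak{m}}$-probability $1$, and on this event $[\beta,e]$ is a unimodular random network under $\mathbf{P}^{\mathfrak{m}}$.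 -/

import Mathlib

open MeasureTheory Set
open scoped ENNReal NNReal Pointwise

namespace FlowNet

universe u v

/-! ## Simple point processes, flow-adaptedness, Palm probabilities -/

section PointProcess

variable {Ω : Type*} {X : Type*}

/-- The measure `B ↦ #(S ∩ B)` on `X` that counts the points of `S`. -/
noncomputable def countingMeasure [MeasurableSpace X] (S : Set X) : Measure X :=
  Measure.count.restrict S

/-- A simple point process on `X`: a random locally finite counting measure without multiple
points, given through its (locally finite) set of atoms `points ω`.  It is measurable for the
cylindrical `σ`-algebra, i.e. `ω ↦ #(points ω ∩ B)` is measurable for each Borel set `B`. -/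
structure SimplePointProcess (Ω : Type*) [MeasurableSpace Ω]
    (X : Type*) [TopologicalSpace X] [MeasurableSpace X] where
  points : Ω → Set X
  finite_inter_compact : ∀ ω, ∀ K : Set X, IsCompact K → (points ω ∩ K).Finite
  measurable_count : ∀ B : Set X, MeasurableSet B →
    Measurable fun ω => countingMeasure (points ω) B

/-- The point process as a map into the measures on `X`. -/
noncomputable def SimplePointProcess.toMeasure [MeasurableSpace Ω] [TopologicalSpace X]
    [MeasurableSpace X] (m : SimplePointProcess Ω X) (ω : Ω) : Measure X :=
  countingMeasure (m.points ω)

/-- `m (x • ω, B) = m (ω, x⁻¹ B)`; the flow is the left action `•` of `X` on `Ω`. -/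
def SimplePointProcess.FlowAdapted [MeasurableSpace Ω] [TopologicalSpace X]
    [MeasurableSpace X] [Group X] [MulAction X Ω] (m : SimplePointProcess Ω X) : Prop :=
  ∀ (x : X) (ω : Ω) (B : Set X), MeasurableSet B →
    m.toMeasure (x • ω) B = m.toMeasure ω (x⁻¹ • B)

/-- The intensity measure `B ↦ 𝐄[m(B)]`. -/
noncomputable def SimplePointProcess.meanMeasure [MeasurableSpace Ω] [TopologicalSpace X]
    [MeasurableSpace X] (m : SimplePointProcess Ω X) (P : Measure Ω) : Measure X :=
  P.bind m.toMeasure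

/-- The number `𝐄[m(B)] / haar(B)`. -/
noncomputable def SimplePointProcess.intensity [MeasurableSpace Ω] [TopologicalSpace X]
    [MeasurableSpace X] (m : SimplePointProcess Ω X) (P : Measure Ω) (haar : Measure X)
    (B : Set X) : ℝ≥0∞ :=
  m.meanMeasure P B / haar B

/-- The Palm measure of `m`,
`A ↦ (1 / intensity) * 𝐄 ∫ 1_{x⁻¹ • ω ∈ A} w(x) m(ω, dx)` (see `palm_apply`), computed with the
reference set `B` for the intensity and with the weight function `w`. -/
noncomputable def SimplePointProcess.palm [MeasurableSpace Ω] [TopologicalSpace X]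
    [MeasurableSpace X] [Group X] [MulAction X Ω] (m : SimplePointProcess Ω X) (P : Measure Ω)
    (haar : Measure X) (B : Set X) (w : X → ℝ≥0) : Measure Ω :=
  (m.intensity P haar B)⁻¹ •
    P.bind fun ω =>
      ((m.toMeasure ω).withDensity fun x => (w x : ℝ≥0∞)).map fun x => x⁻¹ • ω

theorem SimplePointProcess.measurable_toMeasure [MeasurableSpace Ω] [TopologicalSpace X]
    [MeasurableSpace X] (m : SimplePointProcess Ω X) : Measurable m.toMeasure :=
  Measure.measurable_of_measurable_coe _ m.measurable_count

/-- The point process as a kernel. -/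
noncomputable def SimplePointProcess.toKernel [MeasurableSpace Ω] [TopologicalSpace X]
    [MeasurableSpace X] (m : SimplePointProcess Ω X) : ProbabilityTheory.Kernel Ω X :=
  ⟨m.toMeasure, m.measurable_toMeasure⟩

theorem SimplePointProcess.toMeasure_compact_lt_top [MeasurableSpace Ω] [TopologicalSpace X]
    [T2Space X] [MeasurableSpace X] [BorelSpace X] (m : SimplePointProcess Ω X) (ω : Ω)
    {K : Set X} (hK : IsCompact K) : m.toMeasure ω K < ∞ := by
  rw [toMeasure, countingMeasure, Measure.restrict_apply hK.measurableSet, inter_comm]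
  exact Measure.count_apply_lt_top.2 (m.finite_inter_compact ω K hK)

instance SimplePointProcess.isSFiniteKernel_toKernel [MeasurableSpace Ω] [TopologicalSpace X]
    [T2Space X] [SigmaCompactSpace X] [MeasurableSpace X] [BorelSpace X]
    (m : SimplePointProcess Ω X) : ProbabilityTheory.IsSFiniteKernel m.toKernel := by
  classical
  let K : ℕ → Set X := disjointed (compactCovering X)
  have hc : ∀ n, MeasurableSet (compactCovering X n) := fun n =>
    (isCompact_compactCovering X n).measurableSet
  have hK : ∀ n, MeasurableSet (K n) := fun n => MeasurableSet.disjointed hc n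
  have hKfin : ∀ ω n, m.toMeasure ω (K n) < ∞ := fun ω n =>
    (measure_mono (disjointed_subset _ _)).trans_lt
      (m.toMeasure_compact_lt_top ω (isCompact_compactCovering X n))
  let S : ℕ → ℕ → Set Ω := fun n k => {ω | ⌊(m.toMeasure ω (K n)).toNNReal⌋₊ = k}
  have hS : ∀ n k, MeasurableSet (S n k) := fun n k => by
    have h : Measurable fun ω => ⌊(m.toMeasure ω (K n)).toNNReal⌋₊ :=
      Nat.measurable_floor.comp (m.measurable_count _ (hK n)).ennreal_toNNReal
    exact h (measurableSet_singleton k)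
  let κ : ℕ → ℕ → ProbabilityTheory.Kernel Ω X := fun n k =>
    ProbabilityTheory.Kernel.piecewise (hS n k) (m.toKernel.restrict (hK n)) 0
  have hκ : ∀ n k, ProbabilityTheory.IsFiniteKernel (κ n k) := fun n k => by
    refine ⟨⟨(k + 1 : ℝ≥0), ENNReal.coe_lt_top, fun ω => ?_⟩⟩
    by_cases h : ω ∈ S n k
    · simp only [κ, ProbabilityTheory.Kernel.piecewise_apply, if_pos h,
        ProbabilityTheory.Kernel.restrict_apply, Measure.restrict_apply_univ]
      change m.toMeasure ω (K n) ≤ _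
      rw [← ENNReal.coe_toNNReal (hKfin ω n).ne, ENNReal.coe_le_coe]
      have := (Nat.lt_floor_add_one (m.toMeasure ω (K n)).toNNReal).le
      rwa [show ⌊(m.toMeasure ω (K n)).toNNReal⌋₊ = k from h] at this
    · simp [κ, ProbabilityTheory.Kernel.piecewise_apply, if_neg h]
  have hsum : m.toKernel =
      ProbabilityTheory.Kernel.sum fun n => ProbabilityTheory.Kernel.sum fun k => κ n k := by
    ext ω A hA
    rw [ProbabilityTheory.Kernel.sum_apply' _ _ hA]
    have h1 : ∀ n, (ProbabilityTheory.Kernel.sum fun k => κ n k) ω A =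
        m.toKernel ω (A ∩ K n) := fun n => by
      rw [ProbabilityTheory.Kernel.sum_apply' _ _ hA,
        tsum_eq_single ⌊(m.toMeasure ω (K n)).toNNReal⌋₊]
      · simp [κ, S, ProbabilityTheory.Kernel.piecewise_apply,
          ProbabilityTheory.Kernel.restrict_apply, Measure.restrict_apply hA]
      · intro k hk
        have : ω ∉ S n k := fun h => hk h.symm
        simp [κ, ProbabilityTheory.Kernel.piecewise_apply, if_neg this]
    rw [tsum_congr h1, ← measure_iUnion]
    · rw [← inter_iUnion, iUnion_disjointed, iUnion_compactCovering, inter_univ]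
    · exact fun i j hij => (disjoint_disjointed _ hij).mono inter_subset_right inter_subset_right
    · exact fun n => hA.inter (hK n)
  rw [hsum]
  infer_instance

/-- The Palm measure is given by its defining formula. -/
theorem palm_apply [MeasurableSpace Ω] [TopologicalSpace X] [T2Space X] [SigmaCompactSpace X]
    [MeasurableSpace X] [BorelSpace X] [Group X] [IsTopologicalGroup X] [MulAction X Ω]
    [MeasurableSMul₂ X Ω] (m : SimplePointProcess Ω X) (P : Measure Ω) (haar : Measure X)
    (B : Set X) {w : X → ℝ≥0} (hw : Measurable w) {A : Set Ω} (hA : MeasurableSet A) :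
    m.palm P haar B w A = (m.intensity P haar B)⁻¹ *
      ∫⁻ ω, ∫⁻ x, A.indicator 1 (x⁻¹ • ω) * (w x : ℝ≥0∞) ∂(m.toMeasure ω) ∂P := by
  have hsm : Measurable fun p : Ω × X => p.2⁻¹ • p.1 := by
    exact measurable_snd.inv.smul measurable_fst
  have hω : ∀ ω : Ω, Measurable fun x : X => x⁻¹ • ω := fun ω => by
    exact hsm.comp (measurable_const.prodMk measurable_id)
  have key : ∀ {A : Set Ω}, MeasurableSet A → ∀ ω : Ω,
      (((m.toMeasure ω).withDensity fun x => (w x : ℝ≥0∞)).map fun x => x⁻¹ • ω) A =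
        ∫⁻ x, A.indicator 1 (x⁻¹ • ω) * (w x : ℝ≥0∞) ∂(m.toMeasure ω) := by
    intro A hA ω
    rw [Measure.map_apply (hω ω) hA, withDensity_apply _ (hω ω hA),
      ← lintegral_indicator (hω ω hA)]
    refine lintegral_congr fun x => ?_
    by_cases h : x⁻¹ • ω ∈ A <;> simp [indicator, h]
  have hmeas : Measurable fun ω =>
      ((m.toMeasure ω).withDensity fun x => (w x : ℝ≥0∞)).map fun x => x⁻¹ • ω := by
    refine Measure.measurable_of_measurable_coe _ fun A hA => ?_
    simp_rw [key hA]
    have h : Measurable fun p : Ω × X =>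
        (A.indicator 1 (p.2⁻¹ • p.1) * (w p.2 : ℝ≥0∞) : ℝ≥0∞) :=
      ((measurable_one.indicator hA).comp hsm).mul
        (hw.comp measurable_snd).coe_nnreal_ennreal
    exact Measurable.lintegral_kernel_prod_right' (κ := m.toKernel) h
  rw [SimplePointProcess.palm, Measure.smul_apply, smul_eq_mul,
    Measure.bind_apply hA hmeas.aemeasurable]
  simp_rw [key hA]

end PointProcess

/-! ## Networks and their isomorphism classes -/

/-- A connected (or empty), locally finite network with vertex set `V` and mark space `Ξ`.
`edgeMark v w h` is the mark of the pair consisting of the vertex `v` and the incident edge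
`{v, w}`. -/
structure Network (Ξ : Type v) (V : Type u) where
  graph : SimpleGraph V
  preconnected : graph.Preconnected
  locallyFinite : ∀ x, (graph.neighborSet x).Finite
  vertexMark : V → Ξ
  edgeMark : ∀ x y, graph.Adj x y → Ξ

/-- A bijection of the vertex sets is an isomorphism of networks if it preserves and reflects
edges and preserves all marks (the edge bijection is determined by the vertex bijection). -/
structure Network.IsIso {Ξ : Type v} {V V' : Type u} (N : Network Ξ V) (N' : Network Ξ V')
    (φ : V ≃ V') : Prop where
  adj_iff : ∀ x y, N.graph.Adj x y ↔ N'.graph.Adj (φ x) (φ y)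
  vertexMark_eq : ∀ x, N.vertexMark x = N'.vertexMark (φ x)
  edgeMark_eq : ∀ x y (h : N.graph.Adj x y) (h' : N'.graph.Adj (φ x) (φ y)),
    N.edgeMark x y h = N'.edgeMark (φ x) (φ y) h'

theorem Network.IsIso.refl {Ξ : Type v} {V : Type u} (N : Network Ξ V) :
    N.IsIso N (Equiv.refl V) :=
  ⟨fun _ _ => Iff.rfl, fun _ => rfl, fun _ _ _ _ => rfl⟩

theorem Network.IsIso.symm {Ξ : Type v} {V V' : Type u} {N : Network Ξ V} {N' : Network Ξ V'}
    {φ : V ≃ V'} (h : N.IsIso N' φ) : N'.IsIso N φ.symm := by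
  refine ⟨fun x y => ?_, fun x => ?_, fun x y hx hy => ?_⟩
  · simpa using (h.adj_iff (φ.symm x) (φ.symm y)).symm
  · simpa using (h.vertexMark_eq (φ.symm x)).symm
  · have := h.edgeMark_eq (φ.symm x) (φ.symm y) hy (by simpa using hx)
    simpa using this.symm

theorem Network.IsIso.trans {Ξ : Type v} {V V' V'' : Type u} {N : Network Ξ V}
    {N' : Network Ξ V'} {N'' : Network Ξ V''} {φ : V ≃ V'} {ψ : V' ≃ V''}
    (h : N.IsIso N' φ) (k : N'.IsIso N'' ψ) : N.IsIso N'' (φ.trans ψ) := by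
  refine ⟨fun x y => ?_, fun x => ?_, fun x y hx hy => ?_⟩
  · exact (h.adj_iff x y).trans (k.adj_iff _ _)
  · exact (h.vertexMark_eq x).trans (k.vertexMark_eq _)
  · have hz := (h.adj_iff x y).1 hx
    exact (h.edgeMark_eq x y hx hz).trans (k.edgeMark_eq _ _ hz hy)

/-- The vertices of the ball of radius `⌈r⌉` around `o`, for the graph distance. -/
def Network.ball {Ξ : Type v} {V : Type u} (N : Network Ξ V) (o : V) (r : ℝ) : Set V :=
  {x | N.graph.dist o x ≤ ⌈r⌉₊}

/-- `φ` is an isomorphism between the graphs induced on the balls of radius `⌈r⌉` around `o` and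
`o'` which maps `o` to `o'`, and corresponding marks are at distance at most `1 / r`. -/
structure Network.IsBallIso {Ξ : Type v} [MetricSpace Ξ] {V V' : Type u} (N : Network Ξ V)
    (o : V) (N' : Network Ξ V') (o' : V') (r : ℝ) (φ : N.ball o r ≃ N'.ball o' r) : Prop where
  adj_iff : ∀ x y, N.graph.Adj x.1 y.1 ↔ N'.graph.Adj (φ x).1 (φ y).1
  root_eq : ∀ x, x.1 = o → (φ x).1 = o'
  vertexMark_dist : ∀ x, dist (N.vertexMark x.1) (N'.vertexMark (φ x).1) ≤ 1 / r
  edgeMark_dist : ∀ x y (h : N.graph.Adj x.1 y.1) (h' : N'.graph.Adj (φ x).1 (φ y).1),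
    dist (N.edgeMark x.1 y.1 h) (N'.edgeMark (φ x).1 (φ y).1 h') ≤ 1 / r

/-- The topology in which a set is open if it contains a `d`-ball around each of its points. -/
@[reducible] def topologyOfDist {α : Type*} (d : α → α → ℝ) : TopologicalSpace α where
  IsOpen U := ∀ a ∈ U, ∃ ε > 0, ∀ b, d a b < ε → b ∈ U
  isOpen_univ := fun _ _ => ⟨1, one_pos, fun _ _ => mem_univ _⟩
  isOpen_inter := by
    rintro U W hU hW a ⟨ha, ha'⟩
    obtain ⟨ε, hε, h⟩ := hU a ha
    obtain ⟨δ, hδ, h'⟩ := hW a ha'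
    exact ⟨min ε δ, lt_min hε hδ, fun b hb =>
      ⟨h b (hb.trans_le (min_le_left _ _)), h' b (hb.trans_le (min_le_right _ _))⟩⟩
  isOpen_sUnion := by
    rintro S hS a ⟨U, hU, ha⟩
    obtain ⟨ε, hε, h⟩ := hS U hU a ha
    exact ⟨ε, hε, fun b hb => ⟨U, hU, h b hb⟩⟩

section Rooted

variable (Ξ : Type v)

/-- A rooted network. -/
structure RootedNetwork where
  V : Type u
  net : Network Ξ V
  root : V

/-- A network with an ordered pair of distinguished vertices. -/
structure BirootedNetwork where
  V : Type u
  net : Network Ξ V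
  root : V
  other : V

/-- Isomorphism of rooted networks. -/
def RootedNetwork.setoid : Setoid (RootedNetwork.{u, v} Ξ) where
  r A B := ∃ φ : A.V ≃ B.V, A.net.IsIso B.net φ ∧ φ A.root = B.root
  iseqv :=
    { refl := fun A => ⟨Equiv.refl _, .refl _, rfl⟩
      symm := by
        rintro A B ⟨φ, h, h₁⟩
        exact ⟨φ.symm, h.symm, by simp [← h₁]⟩
      trans := by
        rintro A B C ⟨φ, h, h₁⟩ ⟨ψ, k, k₁⟩
        exact ⟨φ.trans ψ, h.trans k, by simp [h₁, k₁]⟩ }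

/-- Isomorphism of birooted networks. -/
def BirootedNetwork.setoid : Setoid (BirootedNetwork.{u, v} Ξ) where
  r A B := ∃ φ : A.V ≃ B.V, A.net.IsIso B.net φ ∧ φ A.root = B.root ∧ φ A.other = B.other
  iseqv :=
    { refl := fun A => ⟨Equiv.refl _, .refl _, rfl, rfl⟩
      symm := by
        rintro A B ⟨φ, h, h₁, h₂⟩
        exact ⟨φ.symm, h.symm, by simp [← h₁], by simp [← h₂]⟩
      trans := by
        rintro A B C ⟨φ, h, h₁, h₂⟩ ⟨ψ, k, k₁, k₂⟩
        exact ⟨φ.trans ψ, h.trans k, by simp [h₁, k₁], by simp [h₂, k₂]⟩ }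

/-- The set `𝒢⁎` of isomorphism classes of rooted networks. -/
def RootedClass : Type (max (u + 1) v) := Quotient (RootedNetwork.setoid.{u, v} Ξ)

/-- The set `𝒢⁎⁎` of isomorphism classes of birooted networks. -/
def BirootedClass : Type (max (u + 1) v) := Quotient (BirootedNetwork.setoid.{u, v} Ξ)

variable {Ξ}

/-- The class `[N, o]`. -/
def rootedClass {V : Type u} (N : Network Ξ V) (o : V) : RootedClass.{u, v} Ξ :=
  Quotient.mk (RootedNetwork.setoid Ξ) ⟨V, N, o⟩

/-- The class `[N, o, x]`. -/
def birootedClass {V : Type u} (N : Network Ξ V) (o x : V) : BirootedClass.{u, v} Ξ :=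
  Quotient.mk (BirootedNetwork.setoid Ξ) ⟨V, N, o, x⟩

/-- The distance `2 ^ (-α)` on `𝒢⁎`, where `α` is the supremum of the `r > 0` for which the
`r`-balls around the roots are isomorphic up to an error of `1 / r` in the marks
(`α = 0` if there is no such `r`). -/
noncomputable def RootedClass.dist [MetricSpace Ξ] (a b : RootedClass.{u, v} Ξ) : ℝ :=
  sInf (insert 1 {s : ℝ | ∃ r > 0, s = (2 : ℝ) ^ (-r) ∧
    ∃ (V V' : Type u) (N : Network Ξ V) (N' : Network Ξ V') (o : V) (o' : V'),
      rootedClass N o = a ∧ rootedClass N' o' = b ∧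
      ∃ φ : N.ball o r ≃ N'.ball o' r, N.IsBallIso o N' o' r φ})

/-- The analogous distance on `𝒢⁎⁎`: the second distinguished vertices have to lie in the balls
and to correspond to each other. -/
noncomputable def BirootedClass.dist [MetricSpace Ξ] (a b : BirootedClass.{u, v} Ξ) : ℝ :=
  sInf (insert 1 {s : ℝ | ∃ r > 0, s = (2 : ℝ) ^ (-r) ∧
    ∃ (V V' : Type u) (N : Network Ξ V) (N' : Network Ξ V') (o x : V) (o' x' : V'),
      birootedClass N o x = a ∧ birootedClass N' o' x' = b ∧
      ∃ φ : N.ball o r ≃ N'.ball o' r, N.IsBallIso o N' o' r φ ∧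
        ∃ hx : x ∈ N.ball o r, (φ ⟨x, hx⟩).1 = x'})

noncomputable instance [MetricSpace Ξ] : TopologicalSpace (RootedClass.{u, v} Ξ) :=
  topologyOfDist RootedClass.dist

noncomputable instance [MetricSpace Ξ] : TopologicalSpace (BirootedClass.{u, v} Ξ) :=
  topologyOfDist BirootedClass.dist

noncomputable instance [MetricSpace Ξ] : MeasurableSpace (RootedClass.{u, v} Ξ) := borel _

noncomputable instance [MetricSpace Ξ] : MeasurableSpace (BirootedClass.{u, v} Ξ) := borel _

/-! ## Unimodular random networks -/

/-- `∑_{x ∈ V(G)} g [G, o, x]` as a function of `[G, o]`. -/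
noncomputable def massOut (g : BirootedClass.{u, v} Ξ → ℝ≥0) : RootedClass.{u, v} Ξ → ℝ≥0∞ :=
  Quotient.lift (fun A => ∑' x : A.V, (g (birootedClass A.net A.root x) : ℝ≥0∞)) <| by
    rintro A B ⟨φ, h, h₁⟩
    refine (tsum_congr fun x => ?_).trans
      (φ.tsum_eq fun y => (g (birootedClass B.net B.root y) : ℝ≥0∞))
    exact congrArg (fun c => (g c : ℝ≥0∞)) (Quotient.sound ⟨φ, h, h₁, rfl⟩)

/-- `∑_{x ∈ V(G)} g [G, x, o]` as a function of `[G, o]`. -/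
noncomputable def massIn (g : BirootedClass.{u, v} Ξ → ℝ≥0) : RootedClass.{u, v} Ξ → ℝ≥0∞ :=
  Quotient.lift (fun A => ∑' x : A.V, (g (birootedClass A.net x A.root) : ℝ≥0∞)) <| by
    rintro A B ⟨φ, h, h₁⟩
    refine (tsum_congr fun x => ?_).trans
      (φ.tsum_eq fun y => (g (birootedClass B.net y B.root) : ℝ≥0∞))
    exact congrArg (fun c => (g c : ℝ≥0∞)) (Quotient.sound ⟨φ, h, rfl, h₁⟩)

/-- `N` is a unimodular random network on the probability space `(S, Q)`. -/
structure IsUnimodularRandomNetwork [MetricSpace Ξ] {S : Type*} [MeasurableSpace S]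
    (Q : Measure S) (N : S → RootedClass.{u, v} Ξ) : Prop where
  isProbabilityMeasure : IsProbabilityMeasure Q
  measurable : Measurable N
  massTransport : ∀ g : BirootedClass.{u, v} Ξ → ℝ≥0, Measurable g →
    ∫⁻ s, massOut g (N s) ∂Q = ∫⁻ s, massIn g (N s) ∂Q

end Rooted

/-! ## Networks whose vertices are points of `X` -/

/-- A network whose vertex set is a subset of `X`. -/
structure NetworkIn (Ξ : Type v) (X : Type u) where
  verts : Set X
  net : Network Ξ verts

/-- The network `β (z • ω)` is the shift of `β ω` by `z`, with all marks preserved. -/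
def NetworkFlowAdapted {Ω : Type*} {Ξ : Type v} {X : Type u} [Group X] [MulAction X Ω]
    (β : Ω → NetworkIn Ξ X) : Prop :=
  ∀ (z : X) (ω : Ω),
    (β (z • ω)).verts = (fun x => z * x) '' (β ω).verts ∧
    ∀ (x y : X) (hx : x ∈ (β ω).verts) (hy : y ∈ (β ω).verts)
      (hx' : z * x ∈ (β (z • ω)).verts) (hy' : z * y ∈ (β (z • ω)).verts),
      ((β (z • ω)).net.graph.Adj ⟨z * x, hx'⟩ ⟨z * y, hy'⟩ ↔
        (β ω).net.graph.Adj ⟨x, hx⟩ ⟨y, hy⟩) ∧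
      (β (z • ω)).net.vertexMark ⟨z * x, hx'⟩ = (β ω).net.vertexMark ⟨x, hx⟩ ∧
      ∀ (h' : (β (z • ω)).net.graph.Adj ⟨z * x, hx'⟩ ⟨z * y, hy'⟩)
        (h : (β ω).net.graph.Adj ⟨x, hx⟩ ⟨y, hy⟩),
        (β (z • ω)).net.edgeMark _ _ h' = (β ω).net.edgeMark _ _ h

/-- `ω ↦ [β ω, e]` on the event `{e ∈ V(β)}`. -/
def rootedAtOne {Ω : Type*} {Ξ : Type v} {X : Type u} [One X] (β : Ω → NetworkIn Ξ X)
    (ω : {ω : Ω // (1 : X) ∈ (β ω).verts}) : RootedClass.{u, v} Ξ :=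
  rootedClass (β ω.1).net ⟨1, ω.2⟩

/-- `(ω, x) ↦ [β ω, e, x]` on `{(ω, x) | e ∈ V(β ω), x ∈ V(β ω)}`. -/
def birootedAtOne {Ω : Type*} {Ξ : Type v} {X : Type u} [One X] (β : Ω → NetworkIn Ξ X)
    (p : {p : Ω × X // (1 : X) ∈ (β p.1).verts ∧ p.2 ∈ (β p.1).verts}) :
    BirootedClass.{u, v} Ξ :=
  birootedClass (β p.1.1).net ⟨1, p.2.1⟩ ⟨p.1.2, p.2.2⟩

end FlowNet

/-! A point process `m` seen from each of its points defines the Campbell measure, the image of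
`P(dω) m(ω, dx)` under `(ω, x) ↦ (x⁻¹ • ω, x)`. Stationarity makes it invariant under left
translations of `x`, so uniqueness of the Haar measure splits it into a product `Q ⊗ haar`, where
`Q` is the Palm measure up to normalization (refined Campbell theorem). Exchanging the roles of two
points of `m` under the integral and using right invariance of `haar` then gives Mecke's identity
`∫ ∫ G(ω, x) m(ω, dx) Q(dω) = ∫ ∫ G(x⁻¹ • ω, x⁻¹) m(ω, dx) Q(dω)`. For
`G(ω, x) = g [β ω, e, x]` flow-adaptedness gives `G(x⁻¹ • ω, x⁻¹) = g [β ω, x, e]`, and the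
identity is the mass-transport principle for `[β, e]`. -/

namespace FlowNet

open ProbabilityTheory

theorem lintegral_subtype_comap_of_ae {α : Type*} [MeasurableSpace α] {μ : Measure α}
    {p : α → Prop} (hp : MeasurableSet {a | p a}) (hae : ∀ᵐ a ∂μ, p a) (f : α → ℝ≥0∞) :
    ∫⁻ a : {a // p a}, f a ∂μ.comap Subtype.val = ∫⁻ a, f a ∂μ := by
  refine (lintegral_subtype_comap hp f).trans ?_
  rw [Measure.restrict_eq_self_of_ae_mem (s := {a | p a}) hae]

section InvariantMeasures

theorem snd_restrict_prod_univ_apply {α γ : Type*} [MeasurableSpace α] [MeasurableSpace γ]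
    (μ : Measure (α × γ)) (A : Set α) {B : Set γ} (hB : MeasurableSet B) :
    (μ.restrict (A ×ˢ univ)).snd B = μ (A ×ˢ B) := by
  rw [Measure.snd_apply hB, Measure.restrict_apply (measurable_snd hB), ← univ_prod,
    prod_inter_prod, univ_inter, inter_univ]

theorem fst_withDensity_snd_apply {α γ : Type*} [MeasurableSpace α] [MeasurableSpace γ]
    (μ : Measure (α × γ)) {w : γ → ℝ≥0∞} (hw : Measurable w) {A : Set α} (hA : MeasurableSet A) :
    (μ.withDensity fun p => w p.2).fst A = ∫⁻ x, w x ∂(μ.restrict (A ×ˢ univ)).snd := by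
  rw [Measure.fst_apply hA, withDensity_apply _ (measurable_fst hA), Measure.snd,
    lintegral_map hw measurable_snd, prod_univ]

variable {α X : Type*} [MeasurableSpace α] [Group X] [MeasurableSpace X]

theorem isMulLeftInvariant_snd_restrict_prod_univ [MeasurableMul X] {μ : Measure (α × X)}
    (hμ : ∀ z, μ.map (fun p => (p.1, z * p.2)) = μ) {A : Set α} (hA : MeasurableSet A) :
    (μ.restrict (A ×ˢ univ)).snd.IsMulLeftInvariant := by
  refine ⟨fun z => Measure.ext fun B hB => ?_⟩
  have hz : Measurable fun p : α × X => (p.1, z * p.2) := by fun_prop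
  rw [Measure.map_apply (measurable_const_mul z) hB,
    snd_restrict_prod_univ_apply μ A (measurable_const_mul z hB),
    snd_restrict_prod_univ_apply μ A hB]
  conv_rhs => rw [← hμ z, Measure.map_apply hz (hA.prod hB)]
  rfl

variable [TopologicalSpace X] [IsTopologicalGroup X] [LocallyCompactSpace X]
  [SecondCountableTopology X] [BorelSpace X] {haar : Measure X} [haar.IsHaarMeasure]
  {w : X → ℝ≥0∞}

theorem lintegral_eq_haarScalarFactor (ν : Measure X) [ν.IsMulLeftInvariant]
    [IsLocallyFiniteMeasure ν] (hw1 : ∫⁻ x, w x ∂haar = 1) :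
    ∫⁻ x, w x ∂ν = ν.haarScalarFactor haar := by
  conv_lhs => rw [Measure.isMulLeftInvariant_eq_smul ν haar]
  rw [lintegral_smul_measure, hw1, ENNReal.smul_def, smul_eq_mul, mul_one]

theorem eq_lintegral_smul_haar (ν : Measure X) [ν.IsMulLeftInvariant]
    [IsLocallyFiniteMeasure ν] (hw1 : ∫⁻ x, w x ∂haar = 1) :
    ν = (∫⁻ x, w x ∂ν) • haar := by
  rw [lintegral_eq_haarScalarFactor ν hw1]
  exact Measure.isMulLeftInvariant_eq_smul ν haar

variable {μ : Measure (α × X)} [IsLocallyFiniteMeasure μ.snd]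

theorem isFiniteMeasure_fst_withDensity_snd
    (hμ : ∀ z, μ.map (fun p => (p.1, z * p.2)) = μ) (hw : Measurable w)
    (hw1 : ∫⁻ x, w x ∂haar = 1) : IsFiniteMeasure (μ.withDensity fun p => w p.2).fst := by
  have hsnd : (μ.restrict (univ ×ˢ univ)).snd = μ.snd := by
    rw [univ_prod_univ, Measure.restrict_univ]
  have : μ.snd.IsMulLeftInvariant :=
    hsnd ▸ isMulLeftInvariant_snd_restrict_prod_univ hμ MeasurableSet.univ
  refine ⟨?_⟩
  rw [fst_withDensity_snd_apply μ hw MeasurableSet.univ, hsnd,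
    lintegral_eq_haarScalarFactor μ.snd hw1]
  exact ENNReal.coe_lt_top

theorem eq_fst_withDensity_snd_prod_haar
    (hμ : ∀ z, μ.map (fun p => (p.1, z * p.2)) = μ) (hw : Measurable w)
    (hw1 : ∫⁻ x, w x ∂haar = 1) : μ = (μ.withDensity fun p => w p.2).fst.prod haar := by
  have := isFiniteMeasure_fst_withDensity_snd hμ hw hw1
  refine (Measure.prod_eq fun A B hA hB => ?_).symm
  have := isMulLeftInvariant_snd_restrict_prod_univ hμ hA
  have : IsLocallyFiniteMeasure (μ.restrict (A ×ˢ univ)).snd :=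
    Measure.isLocallyFiniteMeasure_of_le (μ := μ.snd)
      (Measure.map_mono Measure.restrict_le_self measurable_snd)
  rw [fst_withDensity_snd_apply μ hw hA, ← snd_restrict_prod_univ_apply μ A hB, ← smul_eq_mul,
    ← Measure.smul_apply, ← eq_lintegral_smul_haar _ hw1]

end InvariantMeasures

namespace SimplePointProcess

section Points

variable {Ω X : Type*} [MeasurableSpace Ω] [TopologicalSpace X] [MeasurableSpace X]

theorem toMeasure_singleton_ne_zero_iff [MeasurableSingletonClass X] (m : SimplePointProcess Ω X)
    (ω : Ω) (x : X) : m.toMeasure ω {x} ≠ 0 ↔ x ∈ m.points ω := by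
  rw [toMeasure, countingMeasure, Measure.restrict_apply (measurableSet_singleton x)]
  by_cases h : x ∈ m.points ω <;> simp [h]

theorem countable_points [SigmaCompactSpace X] (m : SimplePointProcess Ω X) (ω : Ω) :
    (m.points ω).Countable := by
  rw [← inter_univ (m.points ω), ← iUnion_compactCovering X, inter_iUnion]
  exact countable_iUnion fun n =>
    (m.finite_inter_compact ω _ (isCompact_compactCovering X n)).countable

theorem lintegral_toMeasure [SigmaCompactSpace X] [MeasurableSingletonClass X]
    (m : SimplePointProcess Ω X) (ω : Ω) (f : X → ℝ≥0∞) :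
    ∫⁻ x, f x ∂m.toMeasure ω = ∑' x : m.points ω, f x := by
  rw [toMeasure, countingMeasure, lintegral_countable _ (m.countable_points ω)]
  simp only [Measure.count_singleton, mul_one]

theorem ae_mem_points [SigmaCompactSpace X] [MeasurableSingletonClass X]
    (m : SimplePointProcess Ω X) (ω : Ω) : ∀ᵐ x ∂m.toMeasure ω, x ∈ m.points ω :=
  ae_restrict_mem (m.countable_points ω).measurableSet

instance sFinite_toMeasure [T2Space X] [SigmaCompactSpace X] [BorelSpace X]
    (m : SimplePointProcess Ω X) (ω : Ω) : SFinite (m.toMeasure ω) :=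
  IsSFiniteKernel.sFinite (κ := m.toKernel) ω

theorem measurable_lintegral_toMeasure [T2Space X] [SigmaCompactSpace X] [BorelSpace X]
    (m : SimplePointProcess Ω X) {α : Type*} [MeasurableSpace α] {f : α × X → ℝ≥0∞}
    (hf : Measurable f) {u : α → Ω} (hu : Measurable u) :
    Measurable fun a => ∫⁻ x, f (a, x) ∂m.toMeasure (u a) :=
  hf.lintegral_kernel_prod_right' (κ := m.toKernel.comap u hu)

theorem measurableSet_setOf_mem_points [T2Space X] [SigmaCompactSpace X]
    [SecondCountableTopology X] [BorelSpace X] (m : SimplePointProcess Ω X) :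
    MeasurableSet {p : Ω × X | p.2 ∈ m.points p.1} := by
  have hdiag : MeasurableSet {q : (Ω × X) × X | q.2 = q.1.2} :=
    measurableSet_eq_fun (by fun_prop) (by fun_prop)
  have hmeas : Measurable fun p : Ω × X => m.toMeasure p.1 {p.2} :=
    Kernel.measurable_kernel_prodMk_left (κ := m.toKernel.comap Prod.fst measurable_fst) hdiag
  simp_rw [← toMeasure_singleton_ne_zero_iff]
  exact (hmeas (measurableSet_singleton 0)).compl

end Points

section Flow

variable {Ω X : Type*} [MeasurableSpace Ω] [Group X] [TopologicalSpace X]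
  [MeasurableSpace X] [BorelSpace X] [MulAction X Ω] {m : SimplePointProcess Ω X}

theorem FlowAdapted.mem_points_smul [T2Space X] (hm : m.FlowAdapted) (x y : X) (ω : Ω) :
    y ∈ m.points (x • ω) ↔ x⁻¹ * y ∈ m.points ω := by
  rw [← toMeasure_singleton_ne_zero_iff, ← toMeasure_singleton_ne_zero_iff,
    hm x ω {y} (measurableSet_singleton y), smul_set_singleton, smul_eq_mul]

variable [IsTopologicalGroup X]

theorem FlowAdapted.toMeasure_smul (hm : m.FlowAdapted) (x : X) (ω : Ω) :
    m.toMeasure (x • ω) = (m.toMeasure ω).map (x * ·) := by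
  ext B hB
  rw [hm x ω B hB, Measure.map_apply (measurable_const_mul x) hB, ← preimage_smul]
  rfl

theorem FlowAdapted.lintegral_smul (hm : m.FlowAdapted) (x : X) (ω : Ω) (f : X → ℝ≥0∞) :
    ∫⁻ y, f y ∂m.toMeasure (x • ω) = ∫⁻ y, f (x * y) ∂m.toMeasure ω := by
  rw [hm.toMeasure_smul, (measurableEmbedding_mulLeft x).lintegral_map]

end Flow

section Palm

variable {Ω X : Type*} [MeasurableSpace Ω] [Group X] [TopologicalSpace X]
  [MeasurableSpace X] [MulAction X Ω]

/-- The Campbell measure of `m`, as a measure on `Ω × X`: the intensity measure of the points `x`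
of `m`, each recorded together with the configuration `x⁻¹ • ω` seen from it. -/
noncomputable def campbell (m : SimplePointProcess Ω X) (P : Measure Ω) : Measure (Ω × X) :=
  P.bind fun ω => (m.toMeasure ω).map fun x => (x⁻¹ • ω, x)

/-- The Palm measure of `m` before division by the intensity, computed with the weight function
`w`. -/
noncomputable def unnormalizedPalm (m : SimplePointProcess Ω X) (P : Measure Ω)
    (w : X → ℝ≥0∞) : Measure Ω :=
  ((m.campbell P).withDensity fun p => w p.2).fst

variable [IsTopologicalGroup X] [T2Space X] [BorelSpace X] [MeasurableSMul₂ X Ω]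

section Formulas

variable [SigmaCompactSpace X] (m : SimplePointProcess Ω X) (P : Measure Ω)

theorem measurable_map_inv_smul_toMeasure :
    Measurable fun ω => (m.toMeasure ω).map fun x : X => (x⁻¹ • ω, x) := by
  refine Measure.measurable_of_measurable_coe _ fun A hA => ?_
  have h (ω : Ω) : Measurable fun x : X => (x⁻¹ • ω, x) := by fun_prop
  simp_rw [Measure.map_apply (h _) hA]
  have hpair : Measurable fun p : Ω × X => (p.2⁻¹ • p.1, p.2) := by fun_prop
  exact Kernel.measurable_kernel_prodMk_left (κ := m.toKernel) (hpair hA)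

theorem lintegral_campbell {f : Ω × X → ℝ≥0∞} (hf : Measurable f) :
    ∫⁻ p, f p ∂m.campbell P = ∫⁻ ω, ∫⁻ x, f (x⁻¹ • ω, x) ∂m.toMeasure ω ∂P := by
  rw [campbell, Measure.lintegral_bind m.measurable_map_inv_smul_toMeasure.aemeasurable
    hf.aemeasurable]
  exact lintegral_congr fun ω => lintegral_map hf (by fun_prop)

theorem snd_campbell : (m.campbell P).snd = m.meanMeasure P := by
  refine Measure.ext_of_lintegral _ fun f hf => ?_
  rw [Measure.snd, lintegral_map hf measurable_snd, m.lintegral_campbell P (by fun_prop),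
    meanMeasure, Measure.lintegral_bind m.measurable_toMeasure.aemeasurable hf.aemeasurable]

theorem lintegral_unnormalizedPalm {w : X → ℝ≥0∞} (hw : Measurable w) {f : Ω → ℝ≥0∞}
    (hf : Measurable f) :
    ∫⁻ ω, f ω ∂m.unnormalizedPalm P w =
      ∫⁻ ω, ∫⁻ x, w x * f (x⁻¹ • ω) ∂m.toMeasure ω ∂P := by
  rw [unnormalizedPalm, Measure.fst, lintegral_map hf measurable_fst,
    lintegral_withDensity_eq_lintegral_mul _ (by fun_prop) (by fun_prop),
    m.lintegral_campbell P (by fun_prop)]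
  rfl

theorem palm_eq_inv_intensity_smul (haar : Measure X) (B : Set X) {w : X → ℝ≥0}
    (hw : Measurable w) :
    m.palm P haar B w =
      (m.intensity P haar B)⁻¹ • m.unnormalizedPalm P fun x => (w x : ℝ≥0∞) := by
  ext A hA
  rw [palm_apply m P haar B hw hA, Measure.smul_apply, ← lintegral_indicator_one hA,
    m.lintegral_unnormalizedPalm P (by fun_prop) (measurable_one.indicator hA), smul_eq_mul]
  simp_rw [mul_comm]

end Formulas

variable {m : SimplePointProcess Ω X} {P : Measure Ω}

theorem FlowAdapted.ae_unnormalizedPalm_one_mem_points [SecondCountableTopology X]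
    [SigmaCompactSpace X] (hm : m.FlowAdapted) {w : X → ℝ≥0∞} (hw : Measurable w) :
    ∀ᵐ ω ∂m.unnormalizedPalm P w, (1 : X) ∈ m.points ω := by
  have hE : MeasurableSet {ω | (1 : X) ∈ m.points ω} :=
    measurable_prodMk_right m.measurableSet_setOf_mem_points
  rw [ae_iff, ← compl_ofPred, ← lintegral_indicator_one hE.compl,
    m.lintegral_unnormalizedPalm P hw (measurable_one.indicator hE.compl)]
  refine lintegral_eq_zero_of_ae_eq_zero <| .of_forall fun ω => ?_
  refine lintegral_eq_zero_of_ae_eq_zero ?_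
  filter_upwards [m.ae_mem_points ω] with x hx
  simp [hm.mem_points_smul, hx]

theorem FlowAdapted.lintegral_unnormalizedPalm_lintegral_toMeasure [SigmaCompactSpace X]
    [SecondCountableTopology X] (hm : m.FlowAdapted) {w : X → ℝ≥0∞} (hw : Measurable w)
    {G : Ω × X → ℝ≥0∞} (hG : Measurable G) :
    ∫⁻ ω, ∫⁻ x, G (ω, x) ∂m.toMeasure ω ∂m.unnormalizedPalm P w =
      ∫⁻ p, ∫⁻ x, w (p.2 * x) * G (x⁻¹ • p.1, x⁻¹) ∂m.toMeasure p.1 ∂m.campbell P := by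
  have hGint : Measurable fun ω => ∫⁻ x, G (ω, x) ∂m.toMeasure ω :=
    m.measurable_lintegral_toMeasure hG measurable_id
  rw [m.lintegral_unnormalizedPalm P hw hGint,
    m.lintegral_campbell P (m.measurable_lintegral_toMeasure
      (f := fun q : (Ω × X) × X => w (q.1.2 * q.2) * G (q.2⁻¹ • q.1.1, q.2⁻¹))
      (by fun_prop) measurable_fst)]
  refine lintegral_congr fun ω => ?_
  calc ∫⁻ y, w y * ∫⁻ x, G (y⁻¹ • ω, x) ∂m.toMeasure (y⁻¹ • ω) ∂m.toMeasure ω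
      = ∫⁻ y, ∫⁻ z, w y * G (y⁻¹ • ω, y⁻¹ * z) ∂m.toMeasure ω ∂m.toMeasure ω := by
        refine lintegral_congr fun y => ?_
        rw [hm.lintegral_smul, lintegral_const_mul _ (by fun_prop)]
    _ = ∫⁻ z, ∫⁻ y, w y * G (y⁻¹ • ω, y⁻¹ * z) ∂m.toMeasure ω ∂m.toMeasure ω :=
        lintegral_lintegral_swap (by fun_prop)
    _ = ∫⁻ z, ∫⁻ x, w (z * x) * G (x⁻¹ • z⁻¹ • ω, x⁻¹) ∂m.toMeasure (z⁻¹ • ω)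
          ∂m.toMeasure ω := by
        refine lintegral_congr fun z => ?_
        rw [hm.lintegral_smul]
        simp_rw [mul_inv_cancel_left, mul_inv_rev, inv_inv, mul_smul, smul_inv_smul]

theorem FlowAdapted.ae_palm_one_mem_points [SecondCountableTopology X] [SigmaCompactSpace X]
    (hm : m.FlowAdapted) (haar : Measure X) (B : Set X) {w : X → ℝ≥0} (hw : Measurable w) :
    ∀ᵐ ω ∂m.palm P haar B w, (1 : X) ∈ m.points ω := by
  rw [m.palm_eq_inv_intensity_smul P haar B hw]
  exact Measure.ae_smul_measure (hm.ae_unnormalizedPalm_one_mem_points hw.coe_nnreal_ennreal) _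

variable [SMulInvariantMeasure X Ω P]

theorem FlowAdapted.map_mul_left_campbell [SigmaCompactSpace X] (hm : m.FlowAdapted) (z : X) :
    (m.campbell P).map (fun p => (p.1, z * p.2)) = m.campbell P := by
  refine Measure.ext_of_lintegral _ fun f hf => ?_
  have hz : Measurable fun p : Ω × X => (p.1, z * p.2) := by fun_prop
  rw [lintegral_map hf hz,
    m.lintegral_campbell P (f := fun p => f (p.1, z * p.2)) (hf.comp hz),
    m.lintegral_campbell P hf]
  conv_rhs =>
    rw [← (measurePreserving_smul z P).lintegral_comp_emb (measurableEmbedding_const_smul z)]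
  refine lintegral_congr fun ω => ?_
  rw [hm.lintegral_smul]
  simp_rw [mul_inv_rev, mul_smul, inv_smul_smul]

variable [LocallyCompactSpace X] [SecondCountableTopology X]
  [IsLocallyFiniteMeasure (m.meanMeasure P)] {haar : Measure X} [haar.IsHaarMeasure]

section

variable {w : X → ℝ≥0∞}

theorem FlowAdapted.isFiniteMeasure_unnormalizedPalm (hm : m.FlowAdapted) (hw : Measurable w)
    (hw1 : ∫⁻ x, w x ∂haar = 1) : IsFiniteMeasure (m.unnormalizedPalm P w) := by
  have : IsLocallyFiniteMeasure (m.campbell P).snd := by rwa [snd_campbell]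
  exact isFiniteMeasure_fst_withDensity_snd hm.map_mul_left_campbell hw hw1

theorem FlowAdapted.campbell_eq_unnormalizedPalm_prod (hm : m.FlowAdapted) (hw : Measurable w)
    (hw1 : ∫⁻ x, w x ∂haar = 1) : m.campbell P = (m.unnormalizedPalm P w).prod haar := by
  have : IsLocallyFiniteMeasure (m.campbell P).snd := by rwa [snd_campbell]
  exact eq_fst_withDensity_snd_prod_haar hm.map_mul_left_campbell hw hw1

theorem FlowAdapted.meanMeasure_eq_unnormalizedPalm_univ_smul (hm : m.FlowAdapted)
    (hw : Measurable w) (hw1 : ∫⁻ x, w x ∂haar = 1) :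
    m.meanMeasure P = m.unnormalizedPalm P w univ • haar := by
  have := hm.isFiniteMeasure_unnormalizedPalm (P := P) hw hw1
  rw [← snd_campbell, hm.campbell_eq_unnormalizedPalm_prod hw hw1, Measure.snd,
    Measure.map_snd_prod]

end

theorem FlowAdapted.isProbabilityMeasure_palm (hm : m.FlowAdapted) (hpos : m.meanMeasure P ≠ 0)
    {B : Set X} (hB0 : haar B ≠ 0) (hB1 : haar B ≠ ∞) {w : X → ℝ≥0} (hw : Measurable w)
    (hw1 : ∫⁻ x, (w x : ℝ≥0∞) ∂haar = 1) : IsProbabilityMeasure (m.palm P haar B w) := by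
  set Q := m.unnormalizedPalm P fun x => (w x : ℝ≥0∞)
  have : IsFiniteMeasure Q := hm.isFiniteMeasure_unnormalizedPalm hw.coe_nnreal_ennreal hw1
  have hmean : m.meanMeasure P = Q univ • haar :=
    hm.meanMeasure_eq_unnormalizedPalm_univ_smul hw.coe_nnreal_ennreal hw1
  have hQ0 : Q univ ≠ 0 := fun h => hpos (by rw [hmean, h, zero_smul])
  have hint : m.intensity P haar B = Q univ := by
    rw [intensity, hmean, Measure.smul_apply, smul_eq_mul, ENNReal.mul_div_cancel_right hB0 hB1]
  refine ⟨?_⟩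
  rw [m.palm_eq_inv_intensity_smul P haar B hw, hint, Measure.smul_apply, smul_eq_mul,
    ENNReal.inv_mul_cancel hQ0 (measure_ne_top Q univ)]

section Mecke

variable [haar.IsMulRightInvariant]

theorem FlowAdapted.mecke_unnormalizedPalm (hm : m.FlowAdapted) {w : X → ℝ≥0∞}
    (hw : Measurable w) (hw1 : ∫⁻ x, w x ∂haar = 1) {G : Ω × X → ℝ≥0∞} (hG : Measurable G) :
    ∫⁻ ω, ∫⁻ x, G (ω, x) ∂m.toMeasure ω ∂m.unnormalizedPalm P w =
      ∫⁻ ω, ∫⁻ x, G (x⁻¹ • ω, x⁻¹) ∂m.toMeasure ω ∂m.unnormalizedPalm P w := by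
  have hmeas : Measurable fun p : Ω × X =>
      ∫⁻ x, w (p.2 * x) * G (x⁻¹ • p.1, x⁻¹) ∂m.toMeasure p.1 :=
    m.measurable_lintegral_toMeasure
      (f := fun q : (Ω × X) × X => w (q.1.2 * q.2) * G (q.2⁻¹ • q.1.1, q.2⁻¹))
      (by fun_prop) measurable_fst
  rw [hm.lintegral_unnormalizedPalm_lintegral_toMeasure hw hG,
    hm.campbell_eq_unnormalizedPalm_prod hw hw1, lintegral_prod _ hmeas.aemeasurable]
  refine lintegral_congr fun ω => ?_
  dsimp only
  rw [lintegral_lintegral_swap (by fun_prop)]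
  refine lintegral_congr fun x => ?_
  rw [lintegral_mul_const _ (by fun_prop), lintegral_mul_right_eq_self w, hw1, one_mul]

theorem FlowAdapted.mecke_palm (hm : m.FlowAdapted) (B : Set X) {w : X → ℝ≥0}
    (hw : Measurable w) (hw1 : ∫⁻ x, (w x : ℝ≥0∞) ∂haar = 1) {G : Ω × X → ℝ≥0∞}
    (hG : Measurable G) :
    ∫⁻ ω, ∫⁻ x, G (ω, x) ∂m.toMeasure ω ∂m.palm P haar B w =
      ∫⁻ ω, ∫⁻ x, G (x⁻¹ • ω, x⁻¹) ∂m.toMeasure ω ∂m.palm P haar B w := by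
  rw [m.palm_eq_inv_intensity_smul P haar B hw, lintegral_smul_measure, lintegral_smul_measure,
    hm.mecke_unnormalizedPalm hw.coe_nnreal_ennreal hw1 hG]

end Mecke

end Palm

end SimplePointProcess

universe u v

section Networks

variable {Ω : Type*} {X : Type u} [Group X] {Ξ : Type v} {β : Ω → NetworkIn Ξ X}

open Classical in
/-- The mass `g [β ω, e, x]` sent from `e` to `x` in `β ω`, extended by `0` to the pairs `(ω, x)`
for which `e` or `x` is not a vertex of `β ω`. -/
noncomputable def massFromOne (β : Ω → NetworkIn Ξ X) (g : BirootedClass.{u, v} Ξ → ℝ≥0)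
    (p : Ω × X) : ℝ≥0∞ :=
  if h : (1 : X) ∈ (β p.1).verts ∧ p.2 ∈ (β p.1).verts then g (birootedAtOne β ⟨p, h⟩) else 0

theorem measurable_massFromOne [MeasurableSpace Ω] [MeasurableSpace X] [MetricSpace Ξ]
    (hverts : MeasurableSet {p : Ω × X | p.2 ∈ (β p.1).verts})
    (hβ : Measurable (birootedAtOne β)) {g : BirootedClass.{u, v} Ξ → ℝ≥0} (hg : Measurable g) :
    Measurable (massFromOne β g) := by
  have hone : MeasurableSet {ω | (1 : X) ∈ (β ω).verts} := measurable_prodMk_right hverts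
  classical
  exact Measurable.dite (s := {p : Ω × X | (1 : X) ∈ (β p.1).verts ∧ p.2 ∈ (β p.1).verts})
    (hg.comp hβ).coe_nnreal_ennreal measurable_const ((measurable_fst hone).inter hverts)

theorem massFromOne_eq_of_eq_one (g : BirootedClass.{u, v} Ξ → ℝ≥0) {ω : Ω}
    {o : (β ω).verts} (ho : (o : X) = 1) (x : (β ω).verts) :
    massFromOne β g (ω, x) = g (birootedClass (β ω).net o x) := by
  obtain ⟨_, hone⟩ := o
  subst ho
  exact dif_pos (c := (1 : X) ∈ (β ω).verts ∧ x.1 ∈ (β ω).verts) ⟨hone, x.2⟩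

theorem massOut_rootedAtOne [MeasurableSpace Ω] [TopologicalSpace X] [SigmaCompactSpace X]
    [MeasurableSpace X] [MeasurableSingletonClass X] {m : SimplePointProcess Ω X}
    (hV : ∀ ω, (β ω).verts = m.points ω) (g : BirootedClass.{u, v} Ξ → ℝ≥0)
    (ω : {ω : Ω // (1 : X) ∈ (β ω).verts}) :
    massOut g (rootedAtOne β ω) = ∫⁻ x, massFromOne β g (ω.1, x) ∂m.toMeasure ω := by
  rw [m.lintegral_toMeasure, ← hV]
  exact tsum_congr fun x => (massFromOne_eq_of_eq_one g rfl x).symm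

variable [MulAction X Ω]

theorem NetworkFlowAdapted.mul_mem_verts_smul_iff (hβ : NetworkFlowAdapted β) {z : X} {ω : Ω}
    {x : X} : z * x ∈ (β (z • ω)).verts ↔ x ∈ (β ω).verts := by
  rw [(hβ z ω).1]
  exact (mul_right_injective z).mem_set_image

/-- The isomorphism from `β ω` to its shift `β (z • ω)`. -/
def NetworkFlowAdapted.shiftEquiv (hβ : NetworkFlowAdapted β) (z : X) (ω : Ω) :
    (β ω).verts ≃ (β (z • ω)).verts :=
  (Equiv.mulLeft z).subtypeEquiv fun _ => hβ.mul_mem_verts_smul_iff.symm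

theorem NetworkFlowAdapted.coe_shiftEquiv (hβ : NetworkFlowAdapted β) (z : X) (ω : Ω)
    (a : (β ω).verts) : (hβ.shiftEquiv z ω a : X) = z * a :=
  rfl

theorem NetworkFlowAdapted.isIso_shiftEquiv (hβ : NetworkFlowAdapted β) (z : X) (ω : Ω) :
    (β ω).net.IsIso (β (z • ω)).net (hβ.shiftEquiv z ω) where
  adj_iff a b := ((hβ z ω).2 a b a.2 b.2 _ _).1.symm
  vertexMark_eq a := ((hβ z ω).2 a a a.2 a.2 (hβ.shiftEquiv z ω a).2
    (hβ.shiftEquiv z ω a).2).2.1.symm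
  edgeMark_eq a b h h' := (((hβ z ω).2 a b a.2 b.2 _ _).2.2 h' h).symm

theorem NetworkFlowAdapted.birootedClass_shiftEquiv (hβ : NetworkFlowAdapted β) (z : X) (ω : Ω)
    (a b : (β ω).verts) :
    birootedClass (β (z • ω)).net (hβ.shiftEquiv z ω a) (hβ.shiftEquiv z ω b) =
      birootedClass (β ω).net a b :=
  (Quotient.sound (s := BirootedNetwork.setoid Ξ) ⟨_, hβ.isIso_shiftEquiv z ω, rfl, rfl⟩).symm

theorem NetworkFlowAdapted.massFromOne_inv_smul_inv (hβ : NetworkFlowAdapted β)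
    (g : BirootedClass.{u, v} Ξ → ℝ≥0) {ω : Ω} (hone : (1 : X) ∈ (β ω).verts)
    (x : (β ω).verts) :
    massFromOne β g (x.1⁻¹ • ω, x.1⁻¹) = g (birootedClass (β ω).net x ⟨1, hone⟩) := by
  have hx : (hβ.shiftEquiv x.1⁻¹ ω x : X) = 1 := by rw [coe_shiftEquiv, inv_mul_cancel]
  rw [← hβ.birootedClass_shiftEquiv x.1⁻¹ ω, ← massFromOne_eq_of_eq_one g hx, coe_shiftEquiv,
    mul_one]

theorem NetworkFlowAdapted.massIn_rootedAtOne [MeasurableSpace Ω] [TopologicalSpace X]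
    [SigmaCompactSpace X] [MeasurableSpace X] [MeasurableSingletonClass X]
    {m : SimplePointProcess Ω X} (hβ : NetworkFlowAdapted β)
    (hV : ∀ ω, (β ω).verts = m.points ω) (g : BirootedClass.{u, v} Ξ → ℝ≥0)
    (ω : {ω : Ω // (1 : X) ∈ (β ω).verts}) :
    massIn g (rootedAtOne β ω) =
      ∫⁻ x, massFromOne β g (x⁻¹ • ω.1, x⁻¹) ∂m.toMeasure ω := by
  rw [m.lintegral_toMeasure, ← hV]
  exact tsum_congr fun x => (hβ.massFromOne_inv_smul_inv g ω.2 x).symm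

end Networks

end FlowNet

theorem mainTheorem11_general {X : Type*} [Group X] [TopologicalSpace X] [IsTopologicalGroup X]
    [LocallyCompactSpace X] [SecondCountableTopology X] [T2Space X]
    [MeasurableSpace X] [BorelSpace X]
    (haar : Measure X) [haar.IsHaarMeasure] [haar.IsMulRightInvariant]
    {Ω : Type*} [MeasurableSpace Ω] (P : Measure Ω)
    [MulAction X Ω] [MeasurableSMul₂ X Ω] [SMulInvariantMeasure X Ω P]
    (m : FlowNet.SimplePointProcess Ω X) (hm : m.FlowAdapted)
    [IsLocallyFiniteMeasure (m.meanMeasure P)] (hpos : m.meanMeasure P ≠ 0)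
    (B : Set X) (hB0 : haar B ≠ 0) (hB1 : haar B ≠ ∞)
    (w : X → ℝ≥0) (hw : Measurable w) (hw1 : ∫⁻ x, (w x : ℝ≥0∞) ∂haar = 1)
    {Ξ : Type*} [MetricSpace Ξ] (β : Ω → FlowNet.NetworkIn Ξ X)
    (hV : ∀ ω, (β ω).verts = m.points ω)
    (hβ : FlowNet.NetworkFlowAdapted β)
    (hmeas : Measurable (FlowNet.rootedAtOne β))
    (hmeas₂ : Measurable (FlowNet.birootedAtOne β)) :
    MeasurableSet {ω : Ω | (1 : X) ∈ (β ω).verts} ∧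
    IsProbabilityMeasure (m.palm P haar B w) ∧
    FlowNet.IsUnimodularRandomNetwork
      ((m.palm P haar B w).comap
        (Subtype.val : {ω : Ω // (1 : X) ∈ (β ω).verts} → Ω))
      (FlowNet.rootedAtOne β) := by
  have hverts : MeasurableSet {p : Ω × X | p.2 ∈ (β p.1).verts} := by
    simpa only [hV] using m.measurableSet_setOf_mem_points
  have hE : MeasurableSet {ω : Ω | (1 : X) ∈ (β ω).verts} := measurable_prodMk_right hverts
  have hprob : IsProbabilityMeasure (m.palm P haar B w) :=
    hm.isProbabilityMeasure_palm hpos hB0 hB1 hw hw1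
  have hae : ∀ᵐ ω ∂m.palm P haar B w, (1 : X) ∈ (β ω).verts := by
    simpa only [hV] using hm.ae_palm_one_mem_points haar B hw
  refine ⟨hE, hprob, ?_, hmeas, fun g hg => ?_⟩
  · exact (MeasurableEmbedding.subtype_coe hE).isProbabilityMeasure_comap (by simpa using hae)
  simp_rw [FlowNet.massOut_rootedAtOne hV, hβ.massIn_rootedAtOne hV]
  rw [FlowNet.lintegral_subtype_comap_of_ae hE hae fun ω =>
      ∫⁻ x, FlowNet.massFromOne β g (ω, x) ∂m.toMeasure ω,
    FlowNet.lintegral_subtype_comap_of_ae hE hae fun ω =>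
      ∫⁻ x, FlowNet.massFromOne β g (x⁻¹ • ω, x⁻¹) ∂m.toMeasure ω]
  exact hm.mecke_palm B hw hw1 (FlowNet.measurable_massFromOne hverts hmeas₂ hg)

theorem mainTheorem11 {X : Type*} [Group X] [TopologicalSpace X] [IsTopologicalGroup X]
    [LocallyCompactSpace X] [SecondCountableTopology X] [T2Space X]
    [MeasurableSpace X] [BorelSpace X]
    -- a left Haar measure, and unimodularity of the group
    (haar : Measure X) [haar.IsHaarMeasure] (hX : haar.IsMulRightInvariant)
    -- the stationary framework
    {Ω : Type*} [MeasurableSpace Ω] (P : Measure Ω) [IsProbabilityMeasure P]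
    [MulAction X Ω] [MeasurableSMul₂ X Ω] [SMulInvariantMeasure X Ω P]
    -- the point process, with intensity in `(0, ∞)`
    (m : FlowNet.SimplePointProcess Ω X) (hm : m.FlowAdapted)
    (hfin : IsLocallyFiniteMeasure (m.meanMeasure P)) (hpos : m.meanMeasure P ≠ 0)
    -- the reference set and the weight function in the definition of the Palm measure
    (B : Set X) (hB : MeasurableSet B) (hB0 : haar B ≠ 0) (hB1 : haar B ≠ ∞)
    (w : X → ℝ≥0) (hw : Measurable w) (hw1 : ∫⁻ x, (w x : ℝ≥0∞) ∂haar = 1)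
    -- the network
    {Ξ : Type*} [MetricSpace Ξ] [CompleteSpace Ξ] [TopologicalSpace.SeparableSpace Ξ]
    (β : Ω → FlowNet.NetworkIn Ξ X)
    (hV : ∀ ω, (β ω).verts = m.points ω)
    (hβ : FlowNet.NetworkFlowAdapted β)
    (hmeas : Measurable (FlowNet.rootedAtOne β))
    (hmeas₂ : Measurable (FlowNet.birootedAtOne β)) :
    MeasurableSet {ω : Ω | (1 : X) ∈ (β ω).verts} ∧
    IsProbabilityMeasure (m.palm P haar B w) ∧
    FlowNet.IsUnimodularRandomNetwork
      ((m.palm P haar B w).comap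
        (Subtype.val : {ω : Ω // (1 : X) ∈ (β ω).verts} → Ω))
      (FlowNet.rootedAtOne β) :=
  mainTheorem11_general haar P m hm hpos B hB0 hB1 w hw hw1 β hV hβ hmeas hmeas₂
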